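/- Let $r:\mathbb{R}^m\to\mathbb{R}\cup\{\infty\}$ be lower semicontinuous and convex, let $\bar x\in\operatorname{dom} r$ and $\bar u\in\partial r(\bar x)$. For $\sigma>0$ write $\operatorname{Prox}_{\sigma r}(x)=\operatorname{argmin}_{u}\{r(u)+\frac{1}{2\sigma}\|u-x\|^2\}$, let $r^*(x)=\sup_{u\in\operatorname{dom}r}\{\langle x,u\rangle-r(u)\}$ be the Fenchel conjugate of $r$, and let $A^\dagger$ be the Moore–Penrose inverse of a matrix $A$. For a Lipschitz mapping $S:\mathbb{R}^m\to\mathbb{R}^m$, let $\overline\nabla S(x)$ be the set of all limits of Jacobian matrices $S'(x^k)$ along sequences $x^k\to x$ of points of differentiability of $S$, let $JS(x)=\operatorname{conv}\overline\nabla S(x)$ be the Clarke generalized Jacobian, and let $D^*S(x)$ be the limiting coderivative, i.e. $z\in D^*S(x)(w)$ if and only if $(z,-w)$ belongs to the limiting (Mordukhovich) normal cone to $\operatorname{gph}S$ at $(x,S(x))$. Put $\mathcal J:=J\operatorname{Prox}_r(\bar x+\bar u)$ and $R:=\bigcup_{W\in\mathcal J}\operatorname{rge}W$. Suppose that $\overline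 W\in\overline\nabla\operatorname{Prox}_r(\bar x+\bar u)$ satisfies $R=\operatorname{rge}\overline W$ and that every $y\in R$ can be written as $y=\overline W\bar z$ with some $\bar z$ such that $$\min\{\langle y,z-y\rangle \mid z\in\mathbb{R}^m,\ W\in\mathcal J,\ y=Wz\}=\langle y,\bar z-y\rangle .$$ Then, for every $U\in\mathcal J$ and every $\sigma>0$, the matrix $I+(\sigma-1)U$ is invertible, and the following hold. 1. For every $\sigma>0$, every $d\in\mathbb{R}^m$, every $z\in D^*\operatorname{Prox}_{\sigma r^*}(\bar u+\sigma\bar x)(d)$, and every $U\in\mathcal J$ with $z=(I+(\sigma-1)U)^{-1}(I-U)d$, $$\|z\|^2\ \ge\ \|(I-UU^\dagger)d\|^2\ \ge\ \|(I-\overline W\,\overline W^\dagger)d\|^2 .$$ 2. For every (fixed) $U\in\mathcal J$ and $d\in\mathbb{R}^m$, $$\big\|\sigma(I+(\sigma-1)U)^{-1}Ud-UU^\dagger d\big\|\to 0\quad\text{as }\sigma\to\infty .$$ -/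

import Mathlib

open Filter Topology

noncomputable section

namespace ProxVar

/-- The Euclidean space `ℝᵐ`. -/
abbrev E (m : ℕ) : Type := EuclideanSpace ℝ (Fin m)

/-- Square real matrices of size `m`. -/
abbrev Mat (m : ℕ) : Type := Matrix (Fin m) (Fin m) ℝ

/-- The product `A x` of a matrix and a vector of the Euclidean space. -/
def app {m : ℕ} (A : Mat m) (x : E m) : E m := WithLp.toLp 2 (A.mulVec x.ofLp)

/-- The range of (the linear map given by) a matrix. -/
def rge {m : ℕ} (A : Mat m) : Set (E m) := Set.range (app A)

/-! ### Extended-real-valued functions -/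

/-- The effective domain. -/
def effDom {m : ℕ} (r : E m → EReal) : Set (E m) := {x | r x < ⊤}

/-- The epigraph, as a subset of `ℝᵐ × ℝ`. -/
def epigraph {m : ℕ} (r : E m → EReal) : Set (E m × ℝ) := {p | r p.1 ≤ (p.2 : EReal)}

/-- Convexity of an extended-real-valued function: its epigraph is convex. -/
def ConvexFun {m : ℕ} (r : E m → EReal) : Prop := Convex ℝ (epigraph r)

/-- The Fenchel conjugate `r*(x) = sup {⟨x, u⟩ - r u | u ∈ dom r}`. -/
def conj {m : ℕ} (r : E m → EReal) (x : E m) : EReal :=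
  ⨆ u ∈ effDom r, (((inner ℝ x u : ℝ) : EReal) - r u)

/-- The regular (Fréchet) subdifferential: `y` such that
`r x' ≥ r x + ⟨y, x' - x⟩ + o(‖x' - x‖)`, at points `x` of the effective domain. -/
def regularSubdiff {m : ℕ} (r : E m → EReal) (x : E m) : Set (E m) :=
  {y | x ∈ effDom r ∧ ∀ ε : ℝ, 0 < ε → ∀ᶠ x' in 𝓝 x,
    r x + ((inner ℝ y (x' - x) - ε * ‖x' - x‖ : ℝ) : EReal) ≤ r x'}

/-- The limiting (Mordukhovich) subdifferential, at points `x` of the effective domain. -/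
def limitingSubdiff {m : ℕ} (r : E m → EReal) (x : E m) : Set (E m) :=
  {y | x ∈ effDom r ∧ ∃ (xs ys : ℕ → E m),
    Tendsto xs atTop (𝓝 x) ∧ Tendsto (fun k => r (xs k)) atTop (𝓝 (r x)) ∧
    (∀ k, ys k ∈ regularSubdiff r (xs k)) ∧ Tendsto ys atTop (𝓝 y)}

/-! ### The proximal mapping -/

/-- The proximal mapping `Prox_{σ r}` as a multifunction:
`Prox_{σ r}(x) = argmin_u {r u + ‖u - x‖² / (2 σ)}`. -/
def proxSet {m : ℕ} (σ : ℝ) (r : E m → EReal) (x : E m) : Set (E m) :=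
  {u | ∀ v : E m, r u + ((1 / (2 * σ) * ‖u - x‖ ^ 2 : ℝ) : EReal) ≤
    r v + ((1 / (2 * σ) * ‖v - x‖ ^ 2 : ℝ) : EReal)}

/-- The proximal mapping as a single-valued mapping: the element of `proxSet σ r x`, which
exists and is unique for `σ > 0` and `r` proper, lower semicontinuous and convex. -/
def prox {m : ℕ} (σ : ℝ) (r : E m → EReal) (x : E m) : E m :=
  Classical.epsilon fun u => u ∈ proxSet σ r x

/-! ### Generalized Jacobians -/

/-- The Jacobian matrix of `S` at `x` (used at points of differentiability only). -/
def jacobian {m : ℕ} (S : E m → E m) (x : E m) : Mat m :=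
  Matrix.of fun i j => (fderiv ℝ S x (EuclideanSpace.single j (1 : ℝ))) i

/-- The limiting Jacobian: limits of Jacobian matrices `S'(xₖ)` along sequences `xₖ → x` of
points of differentiability. -/
def limitingJacobian {m : ℕ} (S : E m → E m) (x : E m) : Set (Mat m) :=
  {V | ∃ xs : ℕ → E m, (∀ k, DifferentiableAt ℝ S (xs k)) ∧ Tendsto xs atTop (𝓝 x) ∧
    Tendsto (fun k => jacobian S (xs k)) atTop (𝓝 V)}

/-- The Clarke generalized Jacobian: the convex hull of the limiting Jacobian. -/
def clarkeJacobian {m : ℕ} (S : E m → E m) (x : E m) : Set (Mat m) :=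
  convexHull ℝ (limitingJacobian S x)

/-! ### Normal cones and coderivatives -/

/-- The regular (Fréchet) normal cone to `C` at `x ∈ C`: those `y` with
`limsup ⟨y, x' - x⟩ / ‖x' - x‖ ≤ 0` as `x' → x`, `x' ∈ C`, `x' ≠ x`. -/
def regularNormalCone {F : Type*} [NormedAddCommGroup F] [InnerProductSpace ℝ F]
    (C : Set F) (x : F) : Set F :=
  {y | x ∈ C ∧ ∀ ε : ℝ, 0 < ε → ∀ᶠ x' in 𝓝[C] x, inner ℝ y (x' - x) ≤ ε * ‖x' - x‖}

/-- The limiting (Mordukhovich) normal cone to `C` at `x ∈ C`. -/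
def limitingNormalCone {F : Type*} [NormedAddCommGroup F] [InnerProductSpace ℝ F]
    (C : Set F) (x : F) : Set F :=
  {y | x ∈ C ∧ ∃ (xs ys : ℕ → F), (∀ k, xs k ∈ C) ∧ Tendsto xs atTop (𝓝 x) ∧
    (∀ k, ys k ∈ regularNormalCone C (xs k)) ∧ Tendsto ys atTop (𝓝 y)}

/-- The graph of a multifunction, in `ℝᵐ × ℝᵐ` with its Euclidean structure. -/
def gph {m : ℕ} (S : E m → Set (E m)) : Set (WithLp 2 (E m × E m)) :=
  {p | p.snd ∈ S p.fst}

/-- The limiting coderivative `D*S(x, u)(w)` of the multifunction `S` at `x` for `u ∈ S x`: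
`z ∈ D*S(x, u)(w)` iff `(z, -w)` is a limiting normal to the graph of `S` at `(x, u)`. -/
def limitingCoderivative {m : ℕ} (S : E m → Set (E m)) (x u w : E m) : Set (E m) :=
  {z | WithLp.toLp 2 (z, -w) ∈ limitingNormalCone (gph S) (WithLp.toLp 2 (x, u))}

/-! ### The Moore–Penrose inverse -/

/-- The four Penrose equations. -/
structure IsMoorePenrose {m : ℕ} (A B : Mat m) : Prop where
  mul_mul_left : A * B * A = A
  mul_mul_right : B * A * B = B
  symm_left : (A * B).transpose = A * B
  symm_right : (B * A).transpose = B * A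

theorem exists_isMoorePenrose {m : ℕ} (A : Mat m) : ∃ B, IsMoorePenrose A B := by
  obtain ⟨G, hGt, hMGM, hGMG, hGM⟩ : ∃ G : Mat m, G.transpose = G ∧
      (A.transpose * A) * G * (A.transpose * A) = A.transpose * A ∧
      G * (A.transpose * A) * G = G ∧
      (G * (A.transpose * A)).transpose = G * (A.transpose * A) := by
    have hM : (A.transpose * A).IsHermitian := by
      simpa [Matrix.conjTranspose_eq_transpose_of_trivial] using
        Matrix.isHermitian_conjTranspose_mul_self A
    set P : Mat m := (hM.eigenvectorUnitary : Mat m)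
    have hPP : P.transpose * P = 1 := by
      have := Unitary.coe_star_mul_self hM.eigenvectorUnitary
      simpa [Matrix.star_eq_conjTranspose, Matrix.conjTranspose_eq_transpose_of_trivial] using this
    have hs : A.transpose * A = P * Matrix.diagonal hM.eigenvalues * P.transpose := by
      have := hM.spectral_theorem
      rw [Unitary.conjStarAlgAut_apply] at this
      simpa [Matrix.star_eq_conjTranspose, Matrix.conjTranspose_eq_transpose_of_trivial,
        Function.comp_def] using this
    clear_value P
    generalize hM.eigenvalues = l at hs
    have key : ∀ a b : Fin m → ℝ, (P * Matrix.diagonal a * P.transpose) *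
        (P * Matrix.diagonal b * P.transpose) =
        P * Matrix.diagonal (fun i => a i * b i) * P.transpose := by
      intro a b
      calc _ = P * Matrix.diagonal a * (P.transpose * P) * Matrix.diagonal b * P.transpose := by
            simp only [Matrix.mul_assoc]
        _ = _ := by
            rw [hPP, Matrix.mul_one, Matrix.mul_assoc P, Matrix.diagonal_mul_diagonal]
    have hT : ∀ a : Fin m → ℝ, (P * Matrix.diagonal a * P.transpose).transpose =
        P * Matrix.diagonal a * P.transpose := by
      intro a
      simp [Matrix.transpose_mul, Matrix.mul_assoc]
    refine ⟨P * Matrix.diagonal (fun i => (l i)⁻¹) * P.transpose, hT _, ?_, ?_, ?_⟩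
    · rw [hs, key, key]
      simp [mul_inv_mul_cancel]
    · rw [hs, key, key]
      congr 3
      funext i
      by_cases h : l i = 0 <;> simp [h]
    · rw [hs, key, hT]
  refine ⟨G * A.transpose, ?_, ?_, ?_, ?_⟩
  · have h : A * (G * (A.transpose * A) - 1) = 0 := by
      rw [← Matrix.conjTranspose_mul_self_eq_zero,
        Matrix.conjTranspose_eq_transpose_of_trivial, Matrix.transpose_mul,
        Matrix.transpose_sub, hGM, Matrix.transpose_one]
      calc _ = (G * (A.transpose * A) - 1) *
            ((A.transpose * A) * G * (A.transpose * A) - A.transpose * A) := by noncomm_ring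
        _ = 0 := by rw [hMGM, sub_self, Matrix.mul_zero]
    rw [Matrix.mul_sub, Matrix.mul_one, sub_eq_zero] at h
    simpa only [Matrix.mul_assoc] using h
  · calc G * A.transpose * A * (G * A.transpose) = (G * (A.transpose * A) * G) * A.transpose := by
          simp only [Matrix.mul_assoc]
      _ = _ := by rw [hGMG]
  · simp [Matrix.transpose_mul, hGt, Matrix.mul_assoc]
  · simpa only [Matrix.mul_assoc] using hGM

theorem IsMoorePenrose.unique {m : ℕ} {A B C : Mat m} (hB : IsMoorePenrose A B)
    (hC : IsMoorePenrose A C) : B = C := by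
  have h1 : A * B = A * C := by
    calc A * B = (A * C * A) * B := by rw [hC.mul_mul_left]
      _ = (A * C) * (A * B) := by simp only [Matrix.mul_assoc]
      _ = ((A * B) * (A * C)).transpose := by
          rw [Matrix.transpose_mul, hB.symm_left, hC.symm_left]
      _ = ((A * B * A) * C).transpose := by simp only [Matrix.mul_assoc]
      _ = A * C := by rw [hB.mul_mul_left, hC.symm_left]
  have h2 : B * A = C * A := by
    calc B * A = B * (A * C * A) := by rw [hC.mul_mul_left]
      _ = (B * A) * (C * A) := by simp only [Matrix.mul_assoc]
      _ = ((C * A) * (B * A)).transpose := by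
          rw [Matrix.transpose_mul, hB.symm_right, hC.symm_right]
      _ = (C * (A * B * A)).transpose := by simp only [Matrix.mul_assoc]
      _ = C * A := by rw [hB.mul_mul_left, hC.symm_right]
  calc B = B * A * B := hB.mul_mul_right.symm
    _ = C * (A * B) := by rw [h2, Matrix.mul_assoc]
    _ = C * A * C := by rw [h1, Matrix.mul_assoc]
    _ = C := hC.mul_mul_right

/-- The Moore–Penrose inverse of a square real matrix. -/
def pinv {m : ℕ} (A : Mat m) : Mat m := Classical.choose (exists_isMoorePenrose A)

/-! ### The structural assumption -/

/-- The union of the ranges of all matrices of the Clarke Jacobian of `Prox_r` at `x + u`. -/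
def rangeUnion {m : ℕ} (r : E m → EReal) (x u : E m) : Set (E m) :=
  ⋃ W ∈ clarkeJacobian (prox 1 r) (x + u), rge W

/-- The matrix `Wbar` of the limiting Jacobian of `Prox_r` at `x + u` represents the union of the
ranges of all the matrices `W` of the Clarke Jacobian, and each `y` in that union is `Wbar zbar`
for some `zbar` at which the minimum of `⟨y, z - y⟩`, over all `z` and all `W` of the Clarke
Jacobian with `y = W z`, is attained. -/
structure RangeAssumption {m : ℕ} (r : E m → EReal) (x u : E m) (Wbar : Mat m) : Prop where
  mem_limitingJacobian : Wbar ∈ limitingJacobian (prox 1 r) (x + u)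
  range_eq : rangeUnion r x u = rge Wbar
  min_attained : ∀ y ∈ rangeUnion r x u, ∃ zbar : E m, y = app Wbar zbar ∧
    IsLeast {t : ℝ | ∃ z : E m, ∃ W ∈ clarkeJacobian (prox 1 r) (x + u),
      y = app W z ∧ t = inner ℝ y (z - y)} (inner ℝ y (zbar - y))

end ProxVar

end

open ProxVar

/-!
A map `S` is firmly nonexpansive if each `S x - S y` lies in the ball having the segment from `0`
to `x - y` as a diameter. This condition on `S` is closed and convex, so it passes from `Prox_r` to
its difference quotients, hence to its derivatives, their limits and the convex hull of these: every
`U` in the Clarke Jacobian of `Prox_r` is firmly nonexpansive. The estimates are then about one such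
matrix. Since `‖(I - A A†) d‖` is the distance from `d` to `rge A`, it decreases as the range grows,
and `(I + (σ - 1) U)⁻¹ (I - U) = I - σ U (I + (σ - 1) U)⁻¹` bounds it by `‖z‖`. Moreover
`U v = 0` for `v ⊥ rge U`, so that `U U U† = U` and
`σ (I + (σ - 1) U)⁻¹ U - U U† = (I + (σ - 1) U)⁻¹ U (I - U†)`, whose norm is `O(1 / σ)`.
-/

namespace ProxVar

/-! ### Firmly nonexpansive maps -/

section FirmlyNonexpansive

variable {F : Type*} [NormedAddCommGroup F] [InnerProductSpace ℝ F]

/-- Firm nonexpansiveness of a self-map of an inner product space: the property of proximal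
mappings that is inherited by their generalized Jacobians. For linear `S` it amounts to
`‖S x‖² ≤ ⟪S x, x⟫`. -/
def FirmlyNonexpansive (S : F → F) : Prop :=
  ∀ x y, ‖S x - S y‖ ^ 2 ≤ inner ℝ (S x - S y) (x - y)

theorem norm_sq_le_inner_iff_mem_closedBall {v w : F} :
    ‖v‖ ^ 2 ≤ inner ℝ v w ↔ v ∈ Metric.closedBall ((1 / 2 : ℝ) • w) (‖w‖ / 2) := by
  rw [mem_closedBall_iff_norm, ← sq_le_sq₀ (norm_nonneg _) (by positivity), norm_sub_sq_real,
    real_inner_smul_right, norm_smul, mul_pow, div_pow, Real.norm_of_nonneg (by norm_num)]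
  constructor <;> intro h <;> linarith

theorem setOf_firmlyNonexpansive_eq_iInter :
    {S : F → F | FirmlyNonexpansive S} =
      ⋂ (x : F) (y : F), (fun S : F → F => S x - S y) ⁻¹'
        Metric.closedBall ((1 / 2 : ℝ) • (x - y)) (‖x - y‖ / 2) := by
  ext S
  simp only [FirmlyNonexpansive, norm_sq_le_inner_iff_mem_closedBall, Set.mem_ofPred_eq,
    Set.mem_iInter, Set.mem_preimage]

theorem isClosed_setOf_firmlyNonexpansive : IsClosed {S : F → F | FirmlyNonexpansive S} := by
  rw [setOf_firmlyNonexpansive_eq_iInter]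
  exact isClosed_iInter fun x => isClosed_iInter fun y =>
    Metric.isClosed_closedBall.preimage (by fun_prop)

theorem convex_setOf_firmlyNonexpansive : Convex ℝ {S : F → F | FirmlyNonexpansive S} := by
  rw [setOf_firmlyNonexpansive_eq_iInter]
  refine convex_iInter fun x => convex_iInter fun y =>
    (convex_closedBall _ _).is_linear_preimage ⟨fun S T => ?_, fun c S => ?_⟩
  · exact add_sub_add_comm _ _ _ _
  · exact (smul_sub c (S x) (S y)).symm

theorem FirmlyNonexpansive.slope {S : F → F} (hS : FirmlyNonexpansive S) (x : F) {t : ℝ}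
    (ht : 0 < t) : FirmlyNonexpansive fun d => t⁻¹ • (S (x + t • d) - S x) := by
  intro d e
  have h := hS (x + t • d) (x + t • e)
  rw [add_sub_add_left_eq_sub, ← smul_sub, real_inner_smul_right] at h
  rw [← smul_sub, sub_sub_sub_cancel_right, norm_smul, mul_pow, Real.norm_of_nonneg (by positivity),
    real_inner_smul_left]
  calc t⁻¹ ^ 2 * ‖S (x + t • d) - S (x + t • e)‖ ^ 2
      ≤ t⁻¹ ^ 2 * (t * inner ℝ (S (x + t • d) - S (x + t • e)) (d - e)) := by gcongr
    _ = t⁻¹ * inner ℝ (S (x + t • d) - S (x + t • e)) (d - e) := by field_simp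

protected theorem FirmlyNonexpansive.fderiv {S : F → F} (hS : FirmlyNonexpansive S) {x : F}
    (hx : DifferentiableAt ℝ S x) : FirmlyNonexpansive (fderiv ℝ S x) := by
  have hlim : Tendsto (fun (t : ℝ) d => t⁻¹ • (S (x + t • d) - S x)) (𝓝[>] 0)
      (𝓝 (fderiv ℝ S x)) :=
    tendsto_pi_nhds.2 fun d => (hx.hasFDerivAt.hasLineDerivAt d).tendsto_slope_zero_right
  refine isClosed_setOf_firmlyNonexpansive.mem_of_tendsto hlim ?_
  filter_upwards [self_mem_nhdsWithin] with t ht using hS.slope x ht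

theorem FirmlyNonexpansive.add_one_mul_norm_le {S : F → F} (hS : FirmlyNonexpansive S)
    (hS0 : S 0 = 0) {c : ℝ} {g q : F} (hq : S (g - c • q) = q) : (c + 1) * ‖q‖ ≤ ‖g‖ := by
  have h := hS (g - c • q) 0
  rw [hS0, sub_zero, sub_zero, hq, inner_sub_right, real_inner_smul_right,
    real_inner_self_eq_norm_sq] at h
  rcases (norm_nonneg q).eq_or_lt with hq0 | hq0
  · rw [← hq0, mul_zero]
    exact norm_nonneg g
  · refine le_of_mul_le_mul_left ?_ hq0
    linarith [real_inner_le_norm q g]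

end FirmlyNonexpansive

/-! ### Matrices acting on the Euclidean space -/

variable {m : ℕ}

theorem app_eq_toEuclideanCLM (A : Mat m) : app A = Matrix.toEuclideanCLM (𝕜 := ℝ) A := rfl

theorem app_injective : Function.Injective (app : Mat m → E m → E m) := fun _ _ h =>
  (Matrix.toEuclideanCLM (n := Fin m) (𝕜 := ℝ)).injective (DFunLike.coe_injective h)

theorem app_mul (A B : Mat m) (x : E m) : app (A * B) x = app A (app B x) := by
  simp [app_eq_toEuclideanCLM]

theorem app_one_sub (A : Mat m) (x : E m) : app (1 - A) x = x - app A x := by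
  simp [app_eq_toEuclideanCLM]

theorem app_one_add_smul (c : ℝ) (A : Mat m) (x : E m) :
    app (1 + c • A) x = x + c • app A x := by
  simp [app_eq_toEuclideanCLM]

theorem app_zero (A : Mat m) : app A 0 = 0 := by
  simp [app_eq_toEuclideanCLM]

theorem inner_app_left (A : Mat m) (x y : E m) :
    inner ℝ (app A x) y = inner ℝ x (app A.transpose y) := by
  rw [app_eq_toEuclideanCLM, app_eq_toEuclideanCLM, ← ContinuousLinearMap.adjoint_inner_right,
    ← ContinuousLinearMap.star_eq_adjoint, ← map_star, Matrix.star_eq_conjTranspose,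
    Matrix.conjTranspose_eq_transpose_of_trivial]

theorem isMoorePenrose_pinv (A : Mat m) : IsMoorePenrose A (pinv A) :=
  Classical.choose_spec (exists_isMoorePenrose A)

theorem inner_app_one_sub_mul_pinv_app (A : Mat m) (d x : E m) :
    inner ℝ (app (1 - A * pinv A) d) (app A x) = 0 := by
  rw [inner_app_left, Matrix.transpose_sub, Matrix.transpose_one,
    (isMoorePenrose_pinv A).symm_left, app_one_sub, ← app_mul,
    (isMoorePenrose_pinv A).mul_mul_left, sub_self, inner_zero_right]

theorem norm_app_one_sub_mul_pinv_eq_infDist (A : Mat m) (d : E m) :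
    ‖app (1 - A * pinv A) d‖ = Metric.infDist d (rge A) := by
  let K := LinearMap.range (Matrix.toEuclideanCLM (𝕜 := ℝ) A : E m →ₗ[ℝ] E m)
  have hproj : app (A * pinv A) d ∈ K := ⟨app (pinv A) d, (app_mul _ _ _).symm⟩
  rw [app_one_sub]
  refine ((K.norm_eq_iInf_iff_real_inner_eq_zero hproj).2 ?_).trans ?_
  · rintro _ ⟨x, rfl⟩
    rw [← app_one_sub]
    exact inner_app_one_sub_mul_pinv_app A d x
  · rw [Metric.infDist_eq_iInf]
    simp only [dist_eq_norm]
    rfl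

theorem norm_app_one_sub_mul_pinv_anti {A B : Mat m} (h : rge A ⊆ rge B) (d : E m) :
    ‖app (1 - B * pinv B) d‖ ≤ ‖app (1 - A * pinv A) d‖ := by
  simpa only [norm_app_one_sub_mul_pinv_eq_infDist] using
    Metric.infDist_le_infDist_of_subset h (Set.range_nonempty (app A))

theorem isLinearMap_app : IsLinearMap ℝ (app : Mat m → E m → E m) where
  map_add A B := by ext; simp [app_eq_toEuclideanCLM]
  map_smul c A := by ext; simp [app_eq_toEuclideanCLM]

theorem continuous_app : Continuous (app : Mat m → E m → E m) := by
  unfold app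
  fun_prop

theorem app_jacobian (S : E m → E m) (x : E m) : app (jacobian S x) = fderiv ℝ S x := by
  rw [app_eq_toEuclideanCLM]
  refine congrArg DFunLike.coe (ContinuousLinearMap.coe_injective
    ((EuclideanSpace.basisFun (Fin m) ℝ).toBasis.ext fun j => ?_))
  ext i
  simp [jacobian, Matrix.ofLp_toEuclideanCLM]

theorem FirmlyNonexpansive.app_of_mem_clarkeJacobian {S : E m → E m} (hS : FirmlyNonexpansive S)
    {x : E m} {U : Mat m} (hU : U ∈ clarkeJacobian S x) : FirmlyNonexpansive (app U) := by
  have hconv : Convex ℝ (app ⁻¹' {T : E m → E m | FirmlyNonexpansive T}) :=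
    (convex_setOf_firmlyNonexpansive (F := E m)).is_linear_preimage isLinearMap_app
  refine convexHull_min ?_ hconv hU
  rintro V ⟨xs, hdiff, -, hV⟩
  refine (isClosed_setOf_firmlyNonexpansive.preimage continuous_app).mem_of_tendsto hV
    (Eventually.of_forall fun k => ?_)
  simpa only [Set.mem_preimage, Set.mem_ofPred_eq, app_jacobian] using hS.fderiv (hdiff k)

/-! ### Firmly nonexpansive matrices -/

section Resolvent

variable {n K : Type*} [Fintype n] [DecidableEq n] [CommRing K] {A B : Matrix n n K} {c : K}

theorem inv_one_add_smul_mul_one_sub (hA : IsUnit (1 + (c - 1) • A)) :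
    (1 + (c - 1) • A)⁻¹ * (1 - A) = 1 - A * c • (1 + (c - 1) • A)⁻¹ := by
  have hdet := (Matrix.isUnit_iff_isUnit_det _).1 hA
  have hcomm : (1 + (c - 1) • A)⁻¹ * A = A * (1 + (c - 1) • A)⁻¹ := by
    have h : Commute (1 + (c - 1) • A) A :=
      (Commute.one_left A).add_left ((Commute.refl A).smul_left _)
    obtain ⟨u, hu⟩ := hA
    rw [← hu] at h ⊢
    rw [← Matrix.coe_units_inv]
    exact h.units_inv_left.eq
  calc (1 + (c - 1) • A)⁻¹ * (1 - A)
      = (1 + (c - 1) • A)⁻¹ * ((1 + (c - 1) • A) - c • A) := by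
        rw [sub_smul, one_smul]
        congr 1
        abel
    _ = 1 - c • ((1 + (c - 1) • A)⁻¹ * A) := by
        rw [mul_sub, Matrix.nonsing_inv_mul _ hdet, mul_smul_comm]
    _ = 1 - A * c • (1 + (c - 1) • A)⁻¹ := by
        rw [hcomm, mul_smul_comm]

theorem smul_inv_one_add_smul_mul_sub (hA : IsUnit (1 + (c - 1) • A)) (hB : A * (A * B) = A) :
    c • ((1 + (c - 1) • A)⁻¹ * A) - A * B = (1 + (c - 1) • A)⁻¹ * A * (1 - B) := by
  have hdet := (Matrix.isUnit_iff_isUnit_det _).1 hA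
  have h : (1 + (c - 1) • A) * (A * B) = A * B + (c - 1) • A := by
    rw [add_mul, one_mul, smul_mul_assoc, hB]
  calc c • ((1 + (c - 1) • A)⁻¹ * A) - A * B
      = (1 + (c - 1) • A)⁻¹ * (c • A - (1 + (c - 1) • A) * (A * B)) := by
        rw [mul_sub, mul_smul_comm, Matrix.nonsing_inv_mul_cancel_left _ _ hdet]
    _ = (1 + (c - 1) • A)⁻¹ * A * (1 - B) := by
        rw [h, mul_assoc, mul_sub A, mul_one, sub_smul, one_smul]
        congr 1
        abel

end Resolvent

theorem FirmlyNonexpansive.isUnit_one_add_smul {U : Mat m} (hU : FirmlyNonexpansive (app U))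
    {σ : ℝ} (hσ : 0 < σ) : IsUnit (1 + (σ - 1) • U) := by
  rw [← Matrix.mulVec_injective_iff_isUnit]
  refine (injective_iff_map_eq_zero (Matrix.mulVecLin (1 + (σ - 1) • U))).2 fun v hv => ?_
  have hker : WithLp.toLp 2 v + (σ - 1) • app U (WithLp.toLp 2 v) = 0 := by
    rw [← app_one_add_smul]
    exact congrArg (WithLp.toLp 2) hv
  have hfix : app U (0 - (σ - 1) • app U (WithLp.toLp 2 v)) = app U (WithLp.toLp 2 v) := by
    rw [zero_sub, ← eq_neg_of_add_eq_zero_left hker]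
  have hUv : app U (WithLp.toLp 2 v) = 0 := by
    have h := hU.add_one_mul_norm_le (app_zero U) hfix
    rw [sub_add_cancel, norm_zero] at h
    exact norm_le_zero_iff.1 (nonpos_of_mul_nonpos_right h hσ)
  rw [hUv, smul_zero, add_zero] at hker
  exact congrArg WithLp.ofLp hker

theorem FirmlyNonexpansive.norm_app_inv_mul_le {U : Mat m} (hU : FirmlyNonexpansive (app U))
    {σ : ℝ} (hσ : 0 < σ) (g : E m) :
    ‖app ((1 + (σ - 1) • U)⁻¹ * U) g‖ ≤ ‖g‖ / σ := by
  have hdet := (Matrix.isUnit_iff_isUnit_det _).1 (hU.isUnit_one_add_smul hσ)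
  set q := app ((1 + (σ - 1) • U)⁻¹ * U) g
  have hq : app U (g - (σ - 1) • q) = q := by
    have h : q + (σ - 1) • app U q = app U g := by
      rw [← app_one_add_smul, ← app_mul, Matrix.mul_nonsing_inv_cancel_left _ _ hdet]
    rw [app_eq_toEuclideanCLM, map_sub, map_smul, ← app_eq_toEuclideanCLM, ← h,
      add_sub_cancel_right]
  rw [le_div_iff₀' hσ]
  simpa only [sub_add_cancel] using hU.add_one_mul_norm_le (app_zero U) hq

theorem FirmlyNonexpansive.mul_mul_pinv {U : Mat m} (hU : FirmlyNonexpansive (app U)) :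
    U * (U * pinv U) = U := by
  refine app_injective (funext fun d => ?_)
  have h := hU (app (1 - U * pinv U) d) 0
  rw [app_zero, sub_zero, sub_zero, real_inner_comm, inner_app_one_sub_mul_pinv_app] at h
  have hU0 : app U (app (1 - U * pinv U) d) = 0 := by simpa using h.antisymm (sq_nonneg _)
  rw [app_one_sub, app_eq_toEuclideanCLM U, map_sub, sub_eq_zero, ← app_eq_toEuclideanCLM] at hU0
  rw [app_mul, hU0]

theorem FirmlyNonexpansive.norm_app_one_sub_mul_pinv_le {U : Mat m}
    (hU : FirmlyNonexpansive (app U)) {σ : ℝ} (hσ : 0 < σ) (d : E m) :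
    ‖app (1 - U * pinv U) d‖ ≤ ‖app ((1 + (σ - 1) • U)⁻¹ * (1 - U)) d‖ := by
  rw [norm_app_one_sub_mul_pinv_eq_infDist,
    inv_one_add_smul_mul_one_sub (hU.isUnit_one_add_smul hσ), app_one_sub, app_mul, ← dist_eq_norm]
  exact Metric.infDist_le_dist_of_mem (Set.mem_range_self _)

theorem FirmlyNonexpansive.tendsto_smul_app_inv_mul_sub {U : Mat m}
    (hU : FirmlyNonexpansive (app U)) (d : E m) :
    Tendsto (fun σ : ℝ => ‖σ • app ((1 + (σ - 1) • U)⁻¹ * U) d - app (U * pinv U) d‖)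
      atTop (𝓝 0) := by
  have hlim : Tendsto (fun σ : ℝ => ‖app (1 - pinv U) d‖ / σ) atTop (𝓝 0) :=
    tendsto_const_nhds.div_atTop tendsto_id
  refine squeeze_zero' (Eventually.of_forall fun _ => norm_nonneg _) ?_ hlim
  filter_upwards [eventually_gt_atTop 0] with σ hσ
  calc ‖σ • app ((1 + (σ - 1) • U)⁻¹ * U) d - app (U * pinv U) d‖
      = ‖app ((1 + (σ - 1) • U)⁻¹ * U) (app (1 - pinv U) d)‖ := by
        rw [← app_mul, ← smul_inv_one_add_smul_mul_sub (hU.isUnit_one_add_smul hσ) hU.mul_mul_pinv]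
        simp only [app_eq_toEuclideanCLM, map_sub, map_smul, sub_apply, smul_apply]
    _ ≤ ‖app (1 - pinv U) d‖ / σ := hU.norm_app_inv_mul_le hσ _

/-! ### The proximal mapping -/

section Prox

theorem exists_forall_le_of_lowerSemicontinuous {X β : Type*} [TopologicalSpace X] [LinearOrder β]
    {f : X → β} (hf : LowerSemicontinuous f) {x₀ : X} (h : ∀ᶠ x in cocompact X, f x₀ ≤ f x) :
    ∃ u, ∀ v, f u ≤ f v := by
  obtain ⟨C, hC, hCle⟩ := mem_cocompact.1 h
  obtain ⟨u, -, hu⟩ := (hf.lowerSemicontinuousOn _).exists_isMinOn (Set.insert_nonempty x₀ C)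
    (hC.insert x₀)
  refine ⟨u, fun v => ?_⟩
  by_cases hv : v ∈ C
  · exact hu (Set.mem_insert_of_mem x₀ hv)
  · exact (hu (Set.mem_insert x₀ C)).trans (hCle hv)

theorem tendsto_mul_sq_sub_mul_atTop {κ : ℝ} (hκ : 0 < κ) (L : ℝ) :
    Tendsto (fun t : ℝ => κ * t ^ 2 - L * t) atTop atTop := by
  have hfactor : ∀ t : ℝ, κ * t ^ 2 - L * t = t * (κ * t + -L) := fun t => by ring
  simp only [hfactor]
  exact tendsto_id.atTop_mul_atTop₀
    (tendsto_atTop_add_const_right _ _ (tendsto_id.const_mul_atTop hκ))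

variable {r : E m → EReal}

theorem exists_eq_coe_of_mem_effDom {x : E m} (hbot : r x ≠ ⊥) (hx : x ∈ effDom r) :
    ∃ a : ℝ, r x = a :=
  ⟨(r x).toReal, (EReal.coe_toReal hx.ne hbot).symm⟩

theorem ConvexFun.apply_add_smul_sub_le (hr : ConvexFun r) {x y : E m} {a b : ℝ}
    (hx : r x ≤ a) (hy : r y ≤ b) {t : ℝ} (h0 : 0 ≤ t) (h1 : t ≤ 1) :
    r (x + t • (y - x)) ≤ ((a + t * (b - a) : ℝ) : EReal) := by
  have h := hr.add_smul_sub_mem (x := (x, a)) (y := (y, b)) hx hy ⟨h0, h1⟩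
  simpa [epigraph] using h

theorem ConvexFun.exists_sub_mul_norm_le (hr : ConvexFun r) (hr_bot : ∀ x, r x ≠ ⊥)
    (hr_lsc : LowerSemicontinuous r) {x : E m} (hx : x ∈ effDom r) :
    ∃ c L : ℝ, 0 ≤ L ∧ ∀ v, ((c - L * ‖v - x‖ : ℝ) : EReal) ≤ r v := by
  obtain ⟨a, ha⟩ := exists_eq_coe_of_mem_effDom (hr_bot x) hx
  have hmem : x ∈ Metric.closedBall x 1 := Metric.mem_closedBall_self zero_le_one
  obtain ⟨w, -, hw⟩ := (hr_lsc.lowerSemicontinuousOn _).exists_isMinOn ⟨x, hmem⟩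
    (isCompact_closedBall x 1)
  obtain ⟨b, hb⟩ := exists_eq_coe_of_mem_effDom (hr_bot w) (LE.le.trans_lt (b := r x) (hw hmem) hx)
  have hball : ∀ v ∈ Metric.closedBall x 1, (b : EReal) ≤ r v := fun v hv => hb ▸ hw hv
  have hba : b ≤ a := by simpa [ha] using hball x hmem
  refine ⟨b, a - b, sub_nonneg.2 hba, fun v => ?_⟩
  -- A point outside the unit ball is joined to `x` by a segment that meets the unit sphere, where
  -- `r` is at least `b`.
  rcases le_total ‖v - x‖ 1 with hv | hv
  · refine le_trans (EReal.coe_le_coe ?_) (hball v (mem_closedBall_iff_norm.2 hv))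
    exact sub_le_self _ (mul_nonneg (sub_nonneg.2 hba) (norm_nonneg _))
  rcases eq_or_ne (r v) ⊤ with htop | htop
  · exact htop ▸ le_top
  obtain ⟨s, hs⟩ := exists_eq_coe_of_mem_effDom (hr_bot v) (lt_top_iff_ne_top.2 htop)
  have hv0 : 0 < ‖v - x‖ := one_pos.trans_le hv
  have hsphere : b ≤ a + ‖v - x‖⁻¹ * (s - a) := by
    refine EReal.coe_le_coe_iff.1 ((hball (x + ‖v - x‖⁻¹ • (v - x)) ?_).trans
      (hr.apply_add_smul_sub_le ha.le hs.le (by positivity) (inv_le_one_of_one_le₀ hv)))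
    rw [mem_closedBall_iff_norm, add_sub_cancel_left, norm_smul, norm_inv, norm_norm,
      inv_mul_cancel₀ hv0.ne']
  rw [hs, EReal.coe_le_coe_iff]
  have hscaled := mul_le_mul_of_nonneg_left hsphere hv0.le
  rw [mul_add, mul_inv_cancel_left₀ hv0.ne'] at hscaled
  linarith

theorem proxSet_nonempty (hr : ConvexFun r) (hr_bot : ∀ x, r x ≠ ⊥)
    (hr_lsc : LowerSemicontinuous r) (hdom : (effDom r).Nonempty) {σ : ℝ} (hσ : 0 < σ) (x : E m) :
    (proxSet σ r x).Nonempty := by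
  obtain ⟨x₀, hx₀⟩ := hdom
  obtain ⟨c, L, hL, hbound⟩ := hr.exists_sub_mul_norm_le hr_bot hr_lsc hx₀
  obtain ⟨a, ha⟩ := exists_eq_coe_of_mem_effDom (hr_bot x₀) hx₀
  let q : E m → ℝ := fun v => 1 / (2 * σ) * ‖v - x‖ ^ 2
  have hlsc : LowerSemicontinuous fun v => r v + (q v : EReal) :=
    hr_lsc.add' (continuous_coe_real_ereal.comp (by fun_prop)).lowerSemicontinuous fun v =>
      EReal.continuousAt_add (Or.inr (EReal.coe_ne_bot _)) (Or.inr (EReal.coe_ne_top _))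
  have hcoercive : Tendsto (fun v => q v - L * ‖v - x‖) (cocompact (E m)) atTop :=
    (tendsto_mul_sq_sub_mul_atTop (by positivity) L).comp
      (tendsto_norm_cocompact_atTop.comp
        (Homeomorph.subRight x).isClosedEmbedding.tendsto_cocompact)
  refine exists_forall_le_of_lowerSemicontinuous (x₀ := x₀) hlsc ?_
  filter_upwards [hcoercive.eventually_ge_atTop (a + q x₀ - c + L * ‖x - x₀‖)] with v hv
  refine le_trans ?_ (add_le_add_left (hbound v) _)
  rw [ha, ← EReal.coe_add, ← EReal.coe_add, EReal.coe_le_coe_iff]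
  have htriangle := mul_le_mul_of_nonneg_left (norm_sub_le_norm_sub_add_norm_sub v x x₀) hL
  linarith

theorem prox_mem_proxSet (hr : ConvexFun r) (hr_bot : ∀ x, r x ≠ ⊥)
    (hr_lsc : LowerSemicontinuous r) (hdom : (effDom r).Nonempty) {σ : ℝ} (hσ : 0 < σ) (x : E m) :
    prox σ r x ∈ proxSet σ r x :=
  Classical.epsilon_spec (proxSet_nonempty hr hr_bot hr_lsc hdom hσ x)

theorem proxSet_subset_effDom (hdom : (effDom r).Nonempty) (σ : ℝ) (x : E m) :
    proxSet σ r x ⊆ effDom r := by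
  obtain ⟨x₀, hx₀⟩ := hdom
  intro p hp
  have h := (hp x₀).trans_lt (EReal.add_lt_top (ne_of_lt hx₀) (EReal.coe_ne_top _))
  refine lt_top_iff_ne_top (a := r p).2 fun htop => ?_
  rw [htop, EReal.top_add_coe] at h
  exact lt_irrefl _ h

theorem ConvexFun.add_inner_div_le_of_mem_proxSet (hr : ConvexFun r) {σ : ℝ} {x p q : E m}
    (hp : p ∈ proxSet σ r x) {a b : ℝ} (ha : r p = a) (hb : r q = b) :
    a + inner ℝ (x - p) (q - p) / σ ≤ b := by
  -- Compare `p` with the points `p + t • (q - p)` and let `t` tend to `0` from the right.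
  have hcompare : ∀ᶠ t : ℝ in 𝓝[>] 0,
      a + inner ℝ (x - p) (q - p) / σ ≤ b + t * (‖q - p‖ ^ 2 / (2 * σ)) := by
    filter_upwards [Ioo_mem_nhdsGT one_pos] with t ⟨ht0, ht1⟩
    have hmin := (hp (p + t • (q - p))).trans
      (add_le_add_left (hr.apply_add_smul_sub_le ha.le hb.le ht0.le ht1.le) _)
    have hexpand : ‖p + t • (q - p) - x‖ ^ 2 =
        ‖p - x‖ ^ 2 - 2 * t * inner ℝ (x - p) (q - p) + t ^ 2 * ‖q - p‖ ^ 2 := by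
      rw [add_sub_right_comm, norm_add_sq_real, real_inner_smul_right, ← neg_sub x p,
        inner_neg_left, norm_smul, mul_pow, Real.norm_eq_abs, sq_abs]
      ring
    rw [ha, ← EReal.coe_add, ← EReal.coe_add, EReal.coe_le_coe_iff, hexpand] at hmin
    refine le_of_mul_le_mul_left ?_ ht0
    linear_combination hmin
  have hlim : Tendsto (fun t : ℝ => b + t * (‖q - p‖ ^ 2 / (2 * σ))) (𝓝[>] 0) (𝓝 b) := by
    have hcont : Continuous fun t : ℝ => b + t * (‖q - p‖ ^ 2 / (2 * σ)) := by fun_prop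
    simpa using (hcont.tendsto 0).mono_left nhdsWithin_le_nhds
  exact ge_of_tendsto hlim hcompare

theorem ConvexFun.norm_sub_sq_le_inner_of_mem_proxSet (hr : ConvexFun r) (hr_bot : ∀ x, r x ≠ ⊥)
    (hdom : (effDom r).Nonempty) {σ : ℝ} (hσ : 0 < σ) {x y p q : E m}
    (hp : p ∈ proxSet σ r x) (hq : q ∈ proxSet σ r y) :
    ‖p - q‖ ^ 2 ≤ inner ℝ (p - q) (x - y) := by
  obtain ⟨a, ha⟩ := exists_eq_coe_of_mem_effDom (hr_bot p) (proxSet_subset_effDom hdom σ x hp)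
  obtain ⟨b, hb⟩ := exists_eq_coe_of_mem_effDom (hr_bot q) (proxSet_subset_effDom hdom σ y hq)
  have hpq := hr.add_inner_div_le_of_mem_proxSet hp ha hb
  have hqp := hr.add_inner_div_le_of_mem_proxSet hq hb ha
  have hsum : inner ℝ (x - p) (q - p) + inner ℝ (y - q) (p - q) =
      ‖p - q‖ ^ 2 - inner ℝ (p - q) (x - y) := by
    rw [← neg_sub p q, inner_neg_right, neg_add_eq_sub, ← inner_sub_left, real_inner_comm,
      show y - q - (x - p) = (p - q) - (x - y) by abel, inner_sub_right,
      real_inner_self_eq_norm_sq]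
  have hdiv : (inner ℝ (x - p) (q - p) + inner ℝ (y - q) (p - q)) / σ ≤ 0 := by
    rw [add_div]
    linarith
  rw [hsum, div_le_iff₀ hσ, zero_mul] at hdiv
  exact sub_nonpos.1 hdiv

theorem ConvexFun.firmlyNonexpansive_prox (hr : ConvexFun r) (hr_bot : ∀ x, r x ≠ ⊥)
    (hr_lsc : LowerSemicontinuous r) (hdom : (effDom r).Nonempty) {σ : ℝ} (hσ : 0 < σ) :
    FirmlyNonexpansive (prox σ r) := fun x y =>
  hr.norm_sub_sq_le_inner_of_mem_proxSet hr_bot hdom hσ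
    (prox_mem_proxSet hr hr_bot hr_lsc hdom hσ x) (prox_mem_proxSet hr hr_bot hr_lsc hdom hσ y)

end Prox

end ProxVar

theorem mainTheorem2_general {m : ℕ} {S : E m → E m} (hS : FirmlyNonexpansive S) {x : E m}
    {Wbar : Mat m} (hW : ⋃ U ∈ clarkeJacobian S x, rge U ⊆ rge Wbar) :
    (∀ U ∈ clarkeJacobian S x, ∀ σ : ℝ, 0 < σ → IsUnit (1 + (σ - 1) • U)) ∧
    (∀ σ : ℝ, 0 < σ → ∀ d : E m, ∀ U ∈ clarkeJacobian S x,
      ‖app (1 - U * pinv U) d‖ ^ 2 ≤ ‖app ((1 + (σ - 1) • U)⁻¹ * (1 - U)) d‖ ^ 2 ∧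
      ‖app (1 - Wbar * pinv Wbar) d‖ ^ 2 ≤ ‖app (1 - U * pinv U) d‖ ^ 2) ∧
    (∀ U ∈ clarkeJacobian S x, ∀ d : E m,
      Tendsto (fun σ : ℝ => ‖σ • app ((1 + (σ - 1) • U)⁻¹ * U) d - app (U * pinv U) d‖)
        atTop (𝓝 0)) := by
  have hfirm : ∀ U ∈ clarkeJacobian S x, FirmlyNonexpansive (app U) := fun U hU =>
    hS.app_of_mem_clarkeJacobian hU
  refine ⟨fun U hU σ hσ => (hfirm U hU).isUnit_one_add_smul hσ, fun σ hσ d U hU => ⟨?_, ?_⟩,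
    fun U hU d => (hfirm U hU).tendsto_smul_app_inv_mul_sub d⟩
  · gcongr
    exact (hfirm U hU).norm_app_one_sub_mul_pinv_le hσ d
  · gcongr
    exact norm_app_one_sub_mul_pinv_anti (Set.iUnion₂_subset_iff.1 hW U hU) d

theorem mainTheorem2 (m : ℕ) (r : E m → EReal) (hr_bot : ∀ x, r x ≠ ⊥)
    (hr_lsc : LowerSemicontinuous r) (hr_conv : ConvexFun r)
    (xbar ubar : E m) (hx : xbar ∈ effDom r) (hu : ubar ∈ limitingSubdiff r xbar)
    (Wbar : Mat m) (hW : RangeAssumption r xbar ubar Wbar) :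
    -- the inverses in the statement exist
    (∀ U ∈ clarkeJacobian (prox 1 r) (xbar + ubar), ∀ σ : ℝ, 0 < σ →
      IsUnit (1 + (σ - 1) • U)) ∧
    -- the estimates of the norm of elements of the coderivative
    (∀ σ : ℝ, 0 < σ → ∀ d z : E m,
      z ∈ limitingCoderivative (proxSet σ (conj r)) (ubar + σ • xbar)
        (prox σ (conj r) (ubar + σ • xbar)) d →
      ∀ U ∈ clarkeJacobian (prox 1 r) (xbar + ubar),
        z = app ((1 + (σ - 1) • U)⁻¹ * (1 - U)) d →
        ‖app (1 - U * pinv U) d‖ ^ 2 ≤ ‖z‖ ^ 2 ∧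
        ‖app (1 - Wbar * pinv Wbar) d‖ ^ 2 ≤ ‖app (1 - U * pinv U) d‖ ^ 2) ∧
    -- the limit for a fixed matrix as the parameter tends to infinity
    (∀ U ∈ clarkeJacobian (prox 1 r) (xbar + ubar), ∀ d : E m,
      Tendsto (fun σ : ℝ => ‖σ • app ((1 + (σ - 1) • U)⁻¹ * U) d - app (U * pinv U) d‖)
        atTop (𝓝 0)) := by
  obtain ⟨hunit, hnorm, hlim⟩ := mainTheorem2_general
    (hr_conv.firmlyNonexpansive_prox hr_bot hr_lsc ⟨xbar, hx⟩ one_pos) hW.range_eq.subset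
  exact ⟨hunit, fun σ hσ d z _ U hU hz => hz ▸ hnorm σ hσ d U hU, hlim⟩
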